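/- Let $k$ be a field and let $A$ be a left artinian $k$-algebra which is *radical-graded*: there is a decomposition $A=\bigoplus_{i\ge 0}A_i$ into $k$-subspaces with $1\in A_0$, $A_iA_j=A_{i+j}$ for all $i,j\ge 0$, and $A_0$ a semisimple ring. Let $r$ be the Jacobson radical of $A$ and write $A/r=\bigoplus_{i\in\Delta_0}\overline A_i$, where $\{\overline A_i\}_{i\in\Delta_0}$ is the finite set of simple ideals (minimal nonzero two-sided ideals) of $A/r$; each $\overline A_i$ is a $k$-algebra with its own identity. Regard $r/r^2$ as an $A/r$-bimodule by $\bar a\cdot\bar x\cdot\bar b=\overline{axb}$ and put ${}_jM_i=\overline A_j\cdot (r/r^2)\cdot\overline A_i$. The *natural quiver* $\Delta_A$ has vertex set $\Delta_0$, and the number of arrows from $i$ to $j$ is the rank of ${}_jM_i$, i.e. the least cardinality of a set generating it as an $\overline A_j$-$\overline A_i$-bimodule. For a quiver $Q$ with finitely many vertices and a family $\mathcal A=\{A_i\}_{i\in Q_0}$ of $k$-algebras with identity, an *$\mathcal A$-path of length $n\ge 0$* is an expression $a_{n+1}\beta_n a_n\cdots\beta_1a_1$, where $\beta_n\cdots\beta_1$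 is a path of length $n$ in $Q$ (written from right to left; just a vertex $i$ when $n=0$) and the $a$'s are nonzero elements of the algebras at the successive vertices of this path. The *generalized path algebra* $k(Q,\mathcal A)$ is the $k$-space spanned by the $\mathcal A$-paths modulo $k$-linearity in each entry $a_l$ (an expression with a zero entry being $0$), with multiplication $$(b_{m+1}\gamma_m\cdots\gamma_1b_1)(a_{n+1}\beta_n\cdots\beta_1a_1)=b_{m+1}\gamma_m\cdots\gamma_1(b_1a_{n+1})\beta_n\cdots\beta_1a_1$$ if $b_1$ and $a_{n+1}$ lie in the algebra at the same vertex, and $0$ otherwise. It is called *normal* if all $A_i$ are simple algebras. A *relation* is a $k$-linear combination of $\mathcal A$-paths with a common starting vertex and a common ending vertex. A set of linear combinations of $\mathcal A$-paths is *$\mathcal A$-finite* if all the $\mathcal A$-paths occurring in it are built on finitely many paths of $Q$. Let $J$ be the two-sided ideal of $k(Q,\mathcal A)$ generated by all $\mathcal A$-paths of length one, and $\langle\rho\rangle$ the two-sided ideal generated by a set $\rho$. **Theorem 2.4 (Generalized Gabriel Theorem in the radical-graded case).** With $\mathcal A=\{\overline A_i\}_{i\in\Delta_0}$, the generalized path algebra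 $k(\Delta_A,\mathcal A)$ is normal, and there is an $\mathcal A$-finite set $\rho$ of relations on $k(\Delta_A,\mathcal A)$ such that $$A\cong k(\Delta_A,\mathcal A)/\langle\rho\rangle\quad\text{as } k\text{-algebras}$$ and $J^s\subseteq\langle\rho\rangle\subseteq J$ for some positive integer $s$. -/

import Mathlib

noncomputable section

namespace GenPath

universe u v w

/-! ### Generalized path algebras -/

section Words

variable {V : Type u} [Quiver.{w} V] (𝒜 : V → Type v)

/-- Formal `𝒜`-paths in a quiver, from a starting vertex `i` to an ending vertex `j`:
expressions `aₙ₊₁ βₙ aₙ ⋯ a₂ β₁ a₁` with `βₙ ⋯ β₁` a path of the quiver and each `a` an element of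
the algebra at the corresponding vertex.  Factors are composed like functions, from right to left:
an arrow `β : j ⟶ l` is multiplied by `𝒜 l` on the left and by `𝒜 j` on the right.
An `𝒜`-path in the strict sense has all its entries nonzero; a formal path having a zero entry
becomes `0` in the generalized path algebra, so that spans are not affected. -/
inductive APath : V → V → Type (max u v w)
  | nil {i : V} (a : 𝒜 i) : APath i i
  | cons {i j l : V} (a : 𝒜 l) (β : j ⟶ l) (p : APath i j) : APath i l

namespace APath

variable {𝒜}

/-- The underlying path of the quiver. -/
def toPath {i j : V} : APath 𝒜 i j → Quiver.Path i j
  | nil _ => Quiver.Path.nil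
  | cons _ β p => (toPath p).cons β

/-- The length of an `𝒜`-path (the number of its arrows). -/
def length {i j : V} (p : APath 𝒜 i j) : ℕ := p.toPath.length

variable [∀ i, Ring (𝒜 i)]

/-- Multiply the leftmost entry of an `𝒜`-path by an element of the algebra at its end. -/
def lmul {i j : V} (b : 𝒜 j) : APath 𝒜 i j → APath 𝒜 i j
  | nil a => nil (b * a)
  | cons a β p => cons (b * a) β p

/-- `(⋯ γ₁ b₁) · (aₙ₊₁ βₙ ⋯) = ⋯ γ₁ (b₁ aₙ₊₁) βₙ ⋯`, the left factor being written first. -/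
def comp {i j l : V} (q : APath 𝒜 j l) (p : APath 𝒜 i j) : APath 𝒜 i l :=
  match q with
  | nil b => lmul b p
  | cons b γ q' => cons b γ (comp q' p)

theorem one_comp {i j : V} (p : APath 𝒜 i j) : comp (nil 1) p = p := by
  cases p <;> simp [comp, lmul]

theorem comp_one {i j : V} (p : APath 𝒜 i j) : comp p (nil 1) = p := by
  induction p with
  | nil a => simp [comp, lmul]
  | cons a β p ih => simp [comp, ih]

theorem lmul_lmul {i j : V} (c b : 𝒜 j) (p : APath 𝒜 i j) :
    lmul c (lmul b p) = lmul (c * b) p := by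
  cases p <;> simp [lmul, mul_assoc]

theorem lmul_comp {i j l : V} (c : 𝒜 l) (q : APath 𝒜 j l) (p : APath 𝒜 i j) :
    comp (lmul c q) p = lmul c (comp q p) := by
  cases q with
  | nil b => exact (lmul_lmul c b p).symm
  | cons b γ q => rfl

theorem comp_assoc {i j l m : V} (r : APath 𝒜 l m) (q : APath 𝒜 j l) (p : APath 𝒜 i j) :
    comp (comp r q) p = comp r (comp q p) := by
  induction r with
  | nil c => simp [comp, lmul_comp]
  | cons c γ r ih => simp [comp, ih]

end APath

/-- A formal `𝒜`-path together with its starting vertex and its ending vertex. -/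
structure Word where
  src : V
  tgt : V
  path : APath 𝒜 src tgt

end Words

section Free

variable (k : Type*) [Field k] {V : Type u} [Quiver.{w} V] (𝒜 : V → Type v)

/-- The `k`-linear space with basis the set of all formal `𝒜`-paths. -/
def FreeWords : Type _ := Word 𝒜 →₀ k

instance : AddCommGroup (FreeWords k 𝒜) := inferInstanceAs (AddCommGroup (Word 𝒜 →₀ k))

instance : Module k (FreeWords k 𝒜) := inferInstanceAs (Module k (Word 𝒜 →₀ k))

variable {𝒜}

/-- A formal `𝒜`-path as a basis vector. -/
def FreeWords.of (x : Word 𝒜) : FreeWords k 𝒜 := Finsupp.single x 1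

/-- The linear extension of a map defined on the basis of formal `𝒜`-paths. -/
def FreeWords.extend {M : Type*} [AddCommGroup M] [Module k M] (φ : Word 𝒜 → M) :
    FreeWords k 𝒜 →ₗ[k] M :=
  Finsupp.linearCombination k φ

theorem FreeWords.extend_of {M : Type*} [AddCommGroup M] [Module k M] (φ : Word 𝒜 → M)
    (x : Word 𝒜) : FreeWords.extend k φ (.of k x) = φ x :=
  (Finsupp.linearCombination_single k (1 : k) x).trans (one_smul k (φ x))

variable {k} in
theorem FreeWords.induction {P : FreeWords k 𝒜 → Prop} (f : FreeWords k 𝒜) (h0 : P 0)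
    (hadd : ∀ f g, P f → P g → P (f + g)) (hof : ∀ (c : k) x, P (c • .of k x)) : P f := by
  refine Finsupp.induction_linear (motive := P) f h0 hadd fun x c => ?_
  have h := hof c x
  have e : (c • FreeWords.of k x : FreeWords k 𝒜) = (Finsupp.single x c : Word 𝒜 →₀ k) := by
    change c • (Finsupp.single x (1 : k)) = _
    simp
  rwa [e] at h

variable [∀ i, Ring (𝒜 i)]

open Classical in
/-- The product of two formal `𝒜`-paths: concatenation if the vertices match, and `0` otherwise. -/
def Word.mul (x y : Word 𝒜) : FreeWords k 𝒜 :=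
  if h : y.tgt = x.src then .of k ⟨y.src, x.tgt, x.path.comp (h ▸ y.path)⟩ else 0

theorem Word.mul_match {i j l : V} (q : APath 𝒜 j l) (p : APath 𝒜 i j) :
    Word.mul k ⟨j, l, q⟩ ⟨i, j, p⟩ = .of k ⟨i, l, q.comp p⟩ := by
  simp [Word.mul]

theorem Word.mul_of_ne {x y : Word 𝒜} (h : y.tgt ≠ x.src) : Word.mul k x y = 0 := by
  simp [Word.mul, h]

/-- The bilinear extension of the product of formal `𝒜`-paths. -/
def FreeWords.mulHom : FreeWords k 𝒜 →ₗ[k] FreeWords k 𝒜 →ₗ[k] FreeWords k 𝒜 :=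
  FreeWords.extend k fun x => FreeWords.extend k fun y => Word.mul k x y

theorem FreeWords.mulHom_of (x y : Word 𝒜) :
    FreeWords.mulHom k (.of k x) (.of k y) = Word.mul k x y := by
  rw [FreeWords.mulHom, FreeWords.extend_of, FreeWords.extend_of]

theorem FreeWords.mulHom_assoc (f g h : FreeWords k 𝒜) :
    mulHom k (mulHom k f g) h = mulHom k f (mulHom k g h) := by
  induction f using FreeWords.induction with
  | h0 => simp
  | hadd f f' hf hf' => simp [hf, hf']
  | hof a x =>
  induction g using FreeWords.induction with
  | h0 => simp
  | hadd g g' hg hg' => simp only [map_add, LinearMap.add_apply, hg, hg']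
  | hof b y =>
  induction h using FreeWords.induction with
  | h0 => simp
  | hadd h h' hh hh' => simp only [map_add, hh, hh']
  | hof c z =>
  simp only [map_smul, LinearMap.smul_apply]
  congr 3
  obtain ⟨i, j, p⟩ := z
  obtain ⟨j', l, q⟩ := y
  obtain ⟨l', m, r⟩ := x
  rw [mulHom_of, mulHom_of]
  by_cases h1 : l = l'
  · subst h1
    by_cases h2 : j = j'
    · subst h2
      rw [Word.mul_match, Word.mul_match, mulHom_of, mulHom_of, Word.mul_match, Word.mul_match,
        APath.comp_assoc]
    · rw [Word.mul_match, mulHom_of, Word.mul_of_ne k (by exact h2), Word.mul_of_ne k (by exact h2),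
        map_zero]
  · rw [Word.mul_of_ne k (by exact h1), map_zero, LinearMap.zero_apply]
    by_cases h2 : j = j'
    · subst h2
      rw [Word.mul_match, mulHom_of, Word.mul_of_ne k (by exact h1)]
    · rw [Word.mul_of_ne k (by exact h2), map_zero]

variable [Fintype V]

/-- The sum of the identities of the algebras at the vertices. -/
def FreeWords.unit : FreeWords k 𝒜 := ∑ i : V, .of k ⟨i, i, .nil 1⟩

theorem FreeWords.unit_mulHom (f : FreeWords k 𝒜) : mulHom k (unit k) f = f := by
  induction f using FreeWords.induction with
  | h0 => simp
  | hadd f f' hf hf' => simp only [map_add, hf, hf']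
  | hof a x =>
  obtain ⟨i, j, p⟩ := x
  rw [map_smul, unit, map_sum, LinearMap.sum_apply, Finset.sum_eq_single j]
  · rw [mulHom_of, Word.mul_match, APath.one_comp]
  · intro l _ hl
    rw [mulHom_of, Word.mul_of_ne k (by exact hl.symm)]
  · simp

theorem FreeWords.mulHom_unit (f : FreeWords k 𝒜) : mulHom k f (unit k) = f := by
  induction f using FreeWords.induction with
  | h0 => simp
  | hadd f f' hf hf' => simp only [map_add, LinearMap.add_apply, hf, hf']
  | hof a x =>
  obtain ⟨i, j, p⟩ := x
  rw [map_smul, LinearMap.smul_apply, unit, map_sum, Finset.sum_eq_single i]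
  · rw [mulHom_of, Word.mul_match, APath.comp_one]
  · intro l _ hl
    rw [mulHom_of, Word.mul_of_ne k (by exact hl)]
  · simp

instance : Ring (FreeWords k 𝒜) where
  __ := (inferInstance : AddCommGroup (FreeWords k 𝒜))
  mul f g := FreeWords.mulHom k f g
  one := FreeWords.unit k
  mul_assoc := FreeWords.mulHom_assoc k
  one_mul := FreeWords.unit_mulHom k
  mul_one := FreeWords.mulHom_unit k
  left_distrib f g h := map_add (FreeWords.mulHom k f) g h
  right_distrib f g h := by
    change FreeWords.mulHom k (f + g) h = _
    rw [map_add, LinearMap.add_apply]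
    rfl
  zero_mul f := by
    change FreeWords.mulHom k 0 f = 0
    simp
  mul_zero f := map_zero (FreeWords.mulHom k f)

instance : Algebra k (FreeWords k 𝒜) :=
  Algebra.ofModule
    (fun c f g => by
      change FreeWords.mulHom k (c • f) g = c • FreeWords.mulHom k f g
      rw [map_smul, LinearMap.smul_apply])
    (fun c f g => map_smul (FreeWords.mulHom k f) c g)

end Free

section Algebra

variable (k : Type*) [Field k] {V : Type u} [Quiver.{w} V] [Fintype V] (𝒜 : V → Type v)
  [∀ i, Ring (𝒜 i)] [∀ i, Algebra k (𝒜 i)]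

/-- Linearity in one entry.  Since `q · a · p` is the formal path with entry `q₁ a pₙ₊₁` at the
place where `q` and `p` meet, the ideal generated by these relations is the subspace of `FreeWords`
generated by the relations expressing that an `𝒜`-path is `k`-linear in each of its entries. -/
inductive LinRel : FreeWords k 𝒜 → FreeWords k 𝒜 → Prop
  | add {i : V} (a b : 𝒜 i) :
      LinRel (.of k ⟨i, i, .nil (a + b)⟩) (.of k ⟨i, i, .nil a⟩ + .of k ⟨i, i, .nil b⟩)
  | smul {i : V} (c : k) (a : 𝒜 i) :
      LinRel (.of k ⟨i, i, .nil (c • a)⟩) (c • .of k ⟨i, i, .nil a⟩)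

/-- The generalized path algebra `k(Q, 𝒜)` of a quiver `Q` with finitely many vertices and a family
`𝒜` of `k`-algebras indexed by the vertices: the span of the `𝒜`-paths modulo linearity in each
entry, multiplied by concatenation. -/
abbrev PathAlgebra : Type _ := RingQuot (LinRel k 𝒜)

variable {𝒜}

namespace PathAlgebra

/-- The class of an `𝒜`-path in the generalized path algebra. -/
def ofPath {i j : V} (p : APath 𝒜 i j) : PathAlgebra k 𝒜 :=
  RingQuot.mkAlgHom k (LinRel k 𝒜) (.of k ⟨i, j, p⟩)

/-- The two-sided ideal generated by a set. -/
def ideal (ρ : Set (PathAlgebra k 𝒜)) : Ideal (PathAlgebra k 𝒜) := (TwoSidedIdeal.span ρ).asIdeal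

instance (ρ : Set (PathAlgebra k 𝒜)) : (ideal k ρ).IsTwoSided :=
  inferInstanceAs (TwoSidedIdeal.span ρ).asIdeal.IsTwoSided

variable (𝒜) in
/-- The ideal `J` generated by all `𝒜`-paths of length one. -/
def J : Ideal (PathAlgebra k 𝒜) :=
  ideal k {x | ∃ (i j : V) (p : APath 𝒜 i j), p.length = 1 ∧ ofPath k p = x}

/-- A relation is a `k`-linear combination of `𝒜`-paths with the same starting vertex and the same
ending vertex. -/
def IsRelation (σ : PathAlgebra k 𝒜) : Prop :=
  ∃ i j : V, σ ∈ Submodule.span k (Set.range fun p : APath 𝒜 i j => ofPath k p)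

/-- A set of linear combinations of `𝒜`-paths is `𝒜`-finite if all the `𝒜`-paths involved are
constructed from a finite set `T` of paths of the quiver. -/
def IsAFinite (ρ : Set (PathAlgebra k 𝒜)) : Prop :=
  ∃ T : Set (Σ i j : V, Quiver.Path i j), T.Finite ∧ ∀ σ ∈ ρ, σ ∈ Submodule.span k
    {x | ∃ (i j : V) (p : APath 𝒜 i j), (⟨i, j, p.toPath⟩ : Σ i j : V, Quiver.Path i j) ∈ T ∧
      ofPath k p = x}

end PathAlgebra

end Algebra

/-! ### Simple ideals of a semisimple ring -/

/-- A simple ideal: a minimal nonzero two-sided ideal. -/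
structure SimpleIdeal (S : Type v) [Ring S] where
  toIdeal : Ideal S
  isTwoSided : toIdeal.IsTwoSided
  ne_bot : toIdeal ≠ ⊥
  minimal : ∀ K : Ideal S, K.IsTwoSided → K ≤ toIdeal → K = ⊥ ∨ K = toIdeal

section Semisimple

variable {S : Type v} [Ring S] [IsSemisimpleRing S]

theorem exists_right_identity (I : Ideal S) : ∃ e ∈ I, ∀ x ∈ I, x * e = x := by
  obtain ⟨K, hK⟩ := exists_isCompl I
  have h1 : (1 : S) ∈ I ⊔ K := by rw [hK.sup_eq_top]; trivial
  obtain ⟨e, he, f, hf, hef⟩ := Submodule.mem_sup.1 h1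
  refine ⟨e, he, fun x hx => ?_⟩
  have h2 : x * f = x - x * e := by
    rw [eq_sub_iff_add_eq, ← mul_add, add_comm f e, hef, mul_one]
  have h3 : x * f ∈ I ⊓ K :=
    ⟨by rw [h2]; exact I.sub_mem hx (I.mul_mem_left x he), K.mul_mem_left x hf⟩
  rw [hK.inf_eq_bot, Submodule.mem_bot, h2, sub_eq_zero] at h3
  exact h3.symm

/-- A two-sided ideal of a semisimple ring has an identity element. -/
theorem exists_identity (I : Ideal S) [I.IsTwoSided] :
    ∃ e ∈ I, ∀ x ∈ I, e * x = x ∧ x * e = x := by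
  obtain ⟨e, he, hr⟩ := exists_right_identity I
  refine ⟨e, he, fun x hx => ⟨?_, hr x hx⟩⟩
  let N : Ideal S :=
    { carrier := {z | z ∈ I ∧ ∀ y ∈ I, y * z = 0}
      zero_mem' := ⟨I.zero_mem, by simp⟩
      add_mem' := fun {a b} ha hb =>
        ⟨I.add_mem ha.1 hb.1, fun y hy => by rw [mul_add, ha.2 y hy, hb.2 y hy, add_zero]⟩
      smul_mem' := fun c z hz => ⟨I.mul_mem_left c hz.1, fun y hy => by
        rw [smul_eq_mul, ← mul_assoc]
        exact hz.2 _ (I.mul_mem_right c hy)⟩ }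
  obtain ⟨g, hg, hgr⟩ := exists_right_identity N
  have hg0 : g = 0 := by rw [← hgr g hg]; exact hg.2 g hg.1
  have hz : e * x - x ∈ N :=
    ⟨I.sub_mem (I.mul_mem_left e hx) hx, fun y hy => by
      rw [mul_sub, ← mul_assoc, hr y hy, sub_self]⟩
  have := hgr _ hz
  rw [hg0, mul_zero] at this
  exact (sub_eq_zero.1 this.symm)

instance : Finite (SimpleIdeal S) := by
  have h : Finite (fullyInvariantSubmodule S S) :=
    Finite.of_equiv _ (OrderIso.setIsotypicComponents (R := S) (M := S)).toEquiv
  refine Finite.of_injective (β := fullyInvariantSubmodule S S)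
    (fun B => ⟨B.toIdeal, isFullyInvariant_iff_isTwoSided.2 B.isTwoSided⟩) ?_
  rintro ⟨I, _, _, _⟩ ⟨I', _, _, _⟩ h
  cases congrArg Subtype.val h
  rfl

/-- A simple ideal of a semisimple ring, as a ring in its own right: addition and multiplication are
those of the ambient ring, and the identity is the identity element of the ideal. -/
def SimpleIdeal.Component (B : SimpleIdeal S) : Type v := B.toIdeal

instance (B : SimpleIdeal S) : AddCommGroup B.Component :=
  inferInstanceAs (AddCommGroup B.toIdeal)

instance (B : SimpleIdeal S) : Ring B.Component where
  __ := (inferInstance : AddCommGroup B.Component)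
  mul x y := ⟨x.1 * y.1, B.toIdeal.mul_mem_left x.1 y.2⟩
  one := ⟨_, (haveI := B.isTwoSided; exists_identity B.toIdeal).choose_spec.1⟩
  mul_assoc x y z := Subtype.ext (mul_assoc x.1 y.1 z.1)
  one_mul x := Subtype.ext
    ((haveI := B.isTwoSided; exists_identity B.toIdeal).choose_spec.2 x.1 x.2).1
  mul_one x := Subtype.ext
    ((haveI := B.isTwoSided; exists_identity B.toIdeal).choose_spec.2 x.1 x.2).2
  left_distrib x y z := Subtype.ext (mul_add x.1 y.1 z.1)
  right_distrib x y z := Subtype.ext (add_mul x.1 y.1 z.1)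
  zero_mul x := Subtype.ext (zero_mul x.1)
  mul_zero x := Subtype.ext (mul_zero x.1)

variable {k : Type*} [Field k] [Algebra k S]

instance (B : SimpleIdeal S) : Module k B.Component := inferInstanceAs (Module k B.toIdeal)

instance (B : SimpleIdeal S) : Algebra k B.Component :=
  Algebra.ofModule (fun c x y => Subtype.ext (smul_mul_assoc c x.1 y.1))
    (fun c x y => Subtype.ext (mul_smul_comm c x.1 y.1))

end Semisimple

/-! ### The natural quiver of an artinian algebra -/

section NaturalQuiver

variable (A : Type v) [Ring A]

/-- The vertices of the natural quiver: the simple ideals of `A/r`, `r` being the radical. -/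
def NaturalQuiver : Type v := SimpleIdeal (A ⧸ Ring.jacobson A)

variable {A}

/-- The simple ideal `Ā_i` of `A/r` which a vertex `i` of the natural quiver is. -/
def NaturalQuiver.simpleIdeal (i : NaturalQuiver A) : SimpleIdeal (A ⧸ Ring.jacobson A) := i

/-- `Ā_j · X · Ā_i` for `X ⊆ r/r²`, where `r/r²` is an `A/r`-bimodule by `ā · x̄ · b̄ = (axb)‾`:
the additive span of the products `ā · x · b̄` with `ā ∈ Ā_j`, `x ∈ X`, `b̄ ∈ Ā_i`.
Here `r/r²` is regarded as a subset of `A/r²`. -/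
def sandwich (j i : NaturalQuiver A) (X : Set (A ⧸ Ring.jacobson A ^ 2)) :
    AddSubgroup (A ⧸ Ring.jacobson A ^ 2) :=
  AddSubgroup.closure {y | ∃ a x b : A, Ideal.Quotient.mk (Ring.jacobson A) a ∈ j.simpleIdeal.toIdeal ∧
    Ideal.Quotient.mk (Ring.jacobson A ^ 2) x ∈ X ∧
    Ideal.Quotient.mk (Ring.jacobson A) b ∈ i.simpleIdeal.toIdeal ∧
    y = Ideal.Quotient.mk (Ring.jacobson A ^ 2) (a * x * b)}

/-- The bimodule `ⱼMᵢ = Ā_j · r/r² · Ā_i`. -/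
def natBimodule (j i : NaturalQuiver A) : AddSubgroup (A ⧸ Ring.jacobson A ^ 2) :=
  sandwich j i (Ideal.Quotient.mk (Ring.jacobson A ^ 2) '' (Ring.jacobson A : Set A))

/-- The rank of `ⱼMᵢ`: the least cardinality of a set generating it as an
`Ā_j`-`Ā_i`-bimodule. -/
def natRank (j i : NaturalQuiver A) : ℕ :=
  sInf {n | ∃ X : Finset (A ⧸ Ring.jacobson A ^ 2),
    X.card = n ∧ (X : Set (A ⧸ Ring.jacobson A ^ 2)) ⊆ natBimodule j i ∧
      sandwich j i (X : Set (A ⧸ Ring.jacobson A ^ 2)) = natBimodule j i}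

/-- The number of arrows from `i` to `j` is the rank of `ⱼMᵢ`. -/
instance : Quiver.{0} (NaturalQuiver A) where
  Hom i j := Fin (natRank j i)

variable [IsArtinianRing A]

instance : Fintype (NaturalQuiver A) :=
  haveI : Finite (NaturalQuiver A) :=
    inferInstanceAs (Finite (SimpleIdeal (A ⧸ Ring.jacobson A)))
  Fintype.ofFinite _

variable (A) in
/-- The family of algebras attached to the vertices of the natural quiver: the vertex `Ā_i` carries
the simple component `Ā_i` of `A/r`. -/
def vertexAlgebra (i : NaturalQuiver A) : Type v := i.simpleIdeal.Component

instance (i : NaturalQuiver A) : Ring (vertexAlgebra A i) :=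
  inferInstanceAs (Ring (i.simpleIdeal.Component))

instance {k : Type*} [Field k] [Algebra k A] (i : NaturalQuiver A) :
    Algebra k (vertexAlgebra A i) :=
  inferInstanceAs (Algebra k (i.simpleIdeal.Component))

end NaturalQuiver

/-! ### Radical-graded algebras -/

/-- `A` is radical-graded if it has a grading `A = ⨁ Aᵢ` by subspaces (`i ≥ 0`) which is strict,
`Aᵢ Aⱼ = Aᵢ₊ⱼ`, and has `A₀` semisimple. -/
def IsRadicalGraded (k : Type u) (A : Type v) [Field k] [Ring A] [Algebra k A] : Prop :=
  ∃ (𝒢 : ℕ → Submodule k A) (_ : GradedAlgebra 𝒢),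
    (∀ i j, 𝒢 i * 𝒢 j = 𝒢 (i + j)) ∧ IsSemisimpleRing (𝒢 0)

end GenPath

end

/-! The grading splits the projection from `A` to `A/r`. Here `r` is the part of positive degree
(`jacobson_eq_degreeGE`), so `A/r` is identified with the degree zero part, and no separability
assumption is needed to lift it into `A`. Strictness of the grading makes `r²` the part of degree at
least two (`jacobson_sq_eq_degreeGE`), so `r/r²` is a copy of the degree one part, and the
generators counted by the arrows lift to homogeneous elements of degree one (`exists_arrow_lift`).

Sending the entries of a path to degree zero and its arrows to these lifts defines a homomorphism
`PathAlgebra.evalHom` to `A`. It is onto because a strict grading is generated in degrees zero and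
one (`evalHom_surjective`). A path of length `n` lands in degree at least `n`, and high degrees
vanish since `A` is artinian (`exists_degreeGE_eq_bot`), so the kernel contains a power of `J`. It
lies inside `J` because the paths of length zero already map injectively to `A/r`
(`ker_evalHom_le_J`).

It remains to generate the kernel by an `𝒜`-finite set of relations. An ideal containing all paths
of length `s` is generated by its elements that combine parallel paths of length at most `s`
(`PathAlgebra.ideal_shortRelations`), and a finite quiver has only finitely many underlying paths of
bounded length. -/

noncomputable section

namespace GenPath

universe u v w

/-! ### Homomorphisms out of a generalized path algebra -/

section Evaluation

variable {k : Type*} [Field k] {V : Type u} [Quiver.{w} V] {𝒜 : V → Type v}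
  [∀ i, Ring (𝒜 i)] [∀ i, Algebra k (𝒜 i)] {A : Type*} [Ring A] [Algebra k A]

/-- The value of an `𝒜`-path when the entries are mapped by `ι` and the arrows by `g`. -/
def APath.eval (ι : ∀ i, 𝒜 i →ₗ[k] A) (g : ∀ ⦃i j : V⦄, (i ⟶ j) → A) {i j : V} :
    APath 𝒜 i j → A
  | .nil a => ι _ a
  | .cons a β p => ι _ a * g β * p.eval ι g

omit [∀ i, Ring (𝒜 i)] in
theorem APath.length_nil {i : V} (a : 𝒜 i) : (APath.nil a).length = 0 := rfl

omit [∀ i, Ring (𝒜 i)] in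
theorem APath.length_cons {i j l : V} (a : 𝒜 l) (β : j ⟶ l) (p : APath 𝒜 i j) :
    (APath.cons a β p).length = p.length + 1 := rfl

/-- Linear maps from the algebras at the vertices which combine to a homomorphism from their
direct product. -/
structure IsOrthogonalSystem [Fintype V] (ι : ∀ i, 𝒜 i →ₗ[k] A) : Prop where
  map_mul : ∀ i (a b : 𝒜 i), ι i (a * b) = ι i a * ι i b
  orthogonal : ∀ i j, i ≠ j → ∀ (a : 𝒜 i) (b : 𝒜 j), ι i a * ι j b = 0
  sum_one : ∑ i, ι i 1 = 1

variable [Fintype V] {ι : ∀ i, 𝒜 i →ₗ[k] A} (hι : IsOrthogonalSystem ι)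
  (g : ∀ ⦃i j : V⦄, (i ⟶ j) → A)

include hι

theorem APath.eval_lmul {i j : V} (b : 𝒜 j) (p : APath 𝒜 i j) :
    (APath.lmul b p).eval ι g = ι j b * p.eval ι g := by
  cases p <;> simp [APath.lmul, APath.eval, hι.map_mul, mul_assoc]

theorem APath.eval_comp {i j l : V} (q : APath 𝒜 j l) (p : APath 𝒜 i j) :
    (q.comp p).eval ι g = q.eval ι g * p.eval ι g := by
  induction q with
  | nil b => exact APath.eval_lmul hι g b p
  | cons b γ q ih => simp [APath.comp, APath.eval, ih, mul_assoc]

/-- The identities of two different vertices can be inserted where the factors meet, and their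
images are orthogonal. -/
theorem APath.eval_mul_eq_zero {i j j' l : V} (h : j ≠ j') (q : APath 𝒜 j' l) (p : APath 𝒜 i j) :
    q.eval ι g * p.eval ι g = 0 := by
  rw [← APath.comp_one q, ← APath.one_comp p, APath.eval_comp hι, APath.eval_comp hι, mul_assoc,
    ← mul_assoc (APath.eval ι g (.nil 1))]
  simp [APath.eval, hι.orthogonal j' j h.symm]

/-- The evaluation of linear combinations of formal `𝒜`-paths. -/
def FreeWords.evalHom : FreeWords k 𝒜 →ₐ[k] A :=
  AlgHom.ofLinearMap (FreeWords.extend k fun x => x.path.eval ι g)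
    (by
      change FreeWords.extend k _ (FreeWords.unit k) = 1
      rw [FreeWords.unit, map_sum, ← hι.sum_one]
      exact Finset.sum_congr rfl fun i _ => FreeWords.extend_of k _ _)
    (by
      intro f f'
      change FreeWords.extend k _ (FreeWords.mulHom k f f') = _
      induction f using FreeWords.induction with
      | h0 => simp
      | hadd f g hf hg => simp only [map_add, LinearMap.add_apply, hf, hg, add_mul]
      | hof c x =>
      induction f' using FreeWords.induction with
      | h0 => simp
      | hadd f g hf hg => simp only [map_add, hf, hg, mul_add]
      | hof c' y =>
      obtain ⟨i, j, p⟩ := y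
      obtain ⟨j', l, q⟩ := x
      simp only [map_smul, LinearMap.smul_apply, FreeWords.mulHom_of, FreeWords.extend_of,
        smul_mul_assoc, mul_smul_comm]
      congr 2
      by_cases h : j = j'
      · subst h
        rw [Word.mul_match, FreeWords.extend_of, APath.eval_comp hι]
      · rw [Word.mul_of_ne k (by exact h), map_zero, APath.eval_mul_eq_zero hι g h])

theorem FreeWords.evalHom_of (x : Word 𝒜) :
    FreeWords.evalHom hι g (.of k x) = x.path.eval ι g :=
  FreeWords.extend_of k _ x

/-- The evaluation homomorphism from the generalized path algebra. -/
def PathAlgebra.evalHom : PathAlgebra k 𝒜 →ₐ[k] A :=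
  RingQuot.liftAlgHom k ⟨FreeWords.evalHom hι g, by
    rintro _ _ (⟨a, b⟩ | ⟨c, a⟩)
    · simp [FreeWords.evalHom_of, APath.eval]
    · simp [FreeWords.evalHom_of, APath.eval]⟩

theorem PathAlgebra.evalHom_ofPath {i j : V} (p : APath 𝒜 i j) :
    PathAlgebra.evalHom hι g (PathAlgebra.ofPath k p) = p.eval ι g := by
  rw [PathAlgebra.evalHom, PathAlgebra.ofPath, RingQuot.liftAlgHom_mkAlgHom_apply]
  exact FreeWords.evalHom_of hι g _

end Evaluation

/-! ### Ideals of the path algebra and their generation by short relations -/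

namespace PathAlgebra

variable (k : Type*) [Field k] {V : Type u} [Quiver.{w} V] [Fintype V] {𝒜 : V → Type v}
  [∀ i, Ring (𝒜 i)] [∀ i, Algebra k (𝒜 i)]

theorem ofPath_comp {i j l : V} (q : APath 𝒜 j l) (p : APath 𝒜 i j) :
    ofPath k (q.comp p) = ofPath k q * ofPath k p := by
  rw [ofPath, ofPath, ofPath, ← map_mul, ← Word.mul_match k q p, ← FreeWords.mulHom_of]
  rfl

theorem ofPath_mul_of_ne {i j j' l : V} (h : j ≠ j') (q : APath 𝒜 j' l) (p : APath 𝒜 i j) :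
    ofPath k q * ofPath k p = 0 := by
  rw [ofPath, ofPath, ← map_mul]
  have h0 : (FreeWords.of k ⟨j', l, q⟩ * FreeWords.of k ⟨i, j, p⟩ : FreeWords k 𝒜) = 0 :=
    (FreeWords.mulHom_of k _ _).trans (Word.mul_of_ne k h)
  rw [h0, map_zero]

theorem ofPath_cons {i j l : V} (a : 𝒜 l) (β : j ⟶ l) (p : APath 𝒜 i j) :
    ofPath k (.cons a β p) = ofPath k (.cons a β (.nil 1)) * ofPath k p := by
  rw [← ofPath_comp, APath.comp, APath.one_comp]

theorem ofPath_nil_add {i : V} (a b : 𝒜 i) :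
    ofPath k (.nil (a + b)) = ofPath k (.nil a) + ofPath k (.nil b) := by
  rw [ofPath, ofPath, ofPath, ← map_add]
  exact RingQuot.mkAlgHom_rel k (LinRel.add a b)

theorem ofPath_nil_smul {i : V} (c : k) (a : 𝒜 i) :
    ofPath k (.nil (c • a)) = c • ofPath k (.nil a) := by
  rw [ofPath, ofPath, ← map_smul]
  exact RingQuot.mkAlgHom_rel k (LinRel.smul c a)

theorem ofPath_nil_zero (i : V) : ofPath k (.nil (0 : 𝒜 i)) = 0 := by
  simpa using ofPath_nil_smul k 0 (0 : 𝒜 i)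

theorem sum_ofPath_nil_one : ∑ i : V, ofPath k (.nil (1 : 𝒜 i)) = 1 := by
  simp_rw [ofPath]
  rw [← map_sum, ← map_one (RingQuot.mkAlgHom k (LinRel k 𝒜))]
  rfl

variable {k} in
theorem induction {P : PathAlgebra k 𝒜 → Prop} (f : PathAlgebra k 𝒜) (h0 : P 0)
    (hadd : ∀ f g, P f → P g → P (f + g))
    (hof : ∀ (c : k) {i j : V} (p : APath 𝒜 i j), P (c • ofPath k p)) : P f := by
  obtain ⟨f, rfl⟩ := RingQuot.mkAlgHom_surjective k (LinRel k 𝒜) f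
  induction f using FreeWords.induction with
  | h0 => simpa using h0
  | hadd f g hf hg => simpa using hadd _ _ hf hg
  | hof c x => simpa [ofPath] using hof c x.path

variable {k} in
theorem subset_ideal (ρ : Set (PathAlgebra k 𝒜)) : ρ ⊆ ideal k ρ := fun _ h =>
  TwoSidedIdeal.mem_asIdeal.2 (TwoSidedIdeal.subset_span h)

variable {k} in
theorem ideal_le_iff {ρ : Set (PathAlgebra k 𝒜)} {I : Ideal (PathAlgebra k 𝒜)} [I.IsTwoSided] :
    ideal k ρ ≤ I ↔ ρ ⊆ I := by
  refine ⟨fun h => (subset_ideal ρ).trans h, fun h x hx => ?_⟩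
  have h1 : TwoSidedIdeal.span ρ ≤ I.toTwoSided :=
    TwoSidedIdeal.span_le.2 fun y hy => by simpa using h hy
  simpa using h1 (TwoSidedIdeal.mem_asIdeal.1 hx)

/-- The combinations of `𝒜`-paths from `i` to `j` of length at most `s`. -/
def pathsLE (𝒜 : V → Type v) [∀ i, Ring (𝒜 i)] [∀ i, Algebra k (𝒜 i)] (s : ℕ) (i j : V) :
    Submodule k (PathAlgebra k 𝒜) :=
  Submodule.span k {x | ∃ p : APath 𝒜 i j, p.length ≤ s ∧ ofPath k p = x}

/-- The relations in an ideal which involve `𝒜`-paths of length at most `s` only. -/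
def shortRelations (I : Ideal (PathAlgebra k 𝒜)) (s : ℕ) : Set (PathAlgebra k 𝒜) :=
  {x | x ∈ I ∧ ∃ i j, x ∈ pathsLE k 𝒜 s i j}

variable {k}

theorem isRelation_of_mem_shortRelations {I : Ideal (PathAlgebra k 𝒜)} {s : ℕ}
    {x : PathAlgebra k 𝒜} (hx : x ∈ shortRelations k I s) : IsRelation k x := by
  obtain ⟨-, i, j, h⟩ := hx
  refine ⟨i, j, Submodule.span_mono ?_ h⟩
  rintro _ ⟨p, -, rfl⟩
  exact ⟨p, rfl⟩

omit [Fintype V] in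
theorem finite_paths_length_le [Finite V] [∀ i j : V, Finite (i ⟶ j)] (s : ℕ) :
    {x : Σ i j : V, Quiver.Path i j | x.2.2.length ≤ s}.Finite := by
  induction s with
  | zero =>
    refine (Set.finite_range fun i : V =>
      (⟨i, i, Quiver.Path.nil⟩ : Σ i j : V, Quiver.Path i j)).subset ?_
    rintro ⟨i, j, p⟩ h
    cases p with
    | nil => exact ⟨i, rfl⟩
    | cons p β => simp at h
  | succ s ih =>
    have := ih.to_subtype
    refine ((Set.finite_range fun i : V =>
      (⟨i, i, Quiver.Path.nil⟩ : Σ i j : V, Quiver.Path i j)).union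
      (Set.finite_range fun x : Σ y : {x : Σ i j : V, Quiver.Path i j | x.2.2.length ≤ s},
        Σ l : V, y.1.2.1 ⟶ l =>
        (⟨x.1.1.1, x.2.1, x.1.1.2.2.cons x.2.2⟩ : Σ i j : V, Quiver.Path i j))).subset ?_
    rintro ⟨i, j, p⟩ h
    cases p with
    | nil => exact Or.inl ⟨i, rfl⟩
    | cons p β => exact Or.inr ⟨⟨⟨⟨_, _, p⟩, by simpa using h⟩, _, β⟩, rfl⟩

theorem isAFinite_shortRelations [∀ i j : V, Finite (i ⟶ j)] (I : Ideal (PathAlgebra k 𝒜))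
    (s : ℕ) : IsAFinite k (shortRelations k I s) := by
  refine ⟨_, finite_paths_length_le s, ?_⟩
  rintro σ ⟨-, i, j, h⟩
  refine Submodule.span_mono ?_ h
  rintro _ ⟨p, hp, rfl⟩
  exact ⟨i, j, p, hp, rfl⟩

/-- A longer path is a left multiple of a path of length exactly `s`, obtained by peeling off its
last arrows, and the latter is itself a short relation. -/
theorem ofPath_mem_ideal_shortRelations {I : Ideal (PathAlgebra k 𝒜)} {s : ℕ}
    (hI : ∀ (i j : V) (p : APath 𝒜 i j), p.length = s → ofPath k p ∈ I) {i j : V}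
    (p : APath 𝒜 i j) (hp : s ≤ p.length) : ofPath k p ∈ ideal k (shortRelations k I s) := by
  have key : ∀ (i j : V) (p : APath 𝒜 i j), p.length = s →
      ofPath k p ∈ ideal k (shortRelations k I s) := fun i j p h =>
    subset_ideal _ ⟨hI i j p h, i, j, Submodule.subset_span ⟨p, h.le, rfl⟩⟩
  induction p with
  | nil a => exact key _ _ _ (by rw [APath.length_nil] at *; omega)
  | cons a β p ih =>
    rcases hp.eq_or_lt with h | h
    · exact key _ _ _ h.symm
    · rw [ofPath_cons]
      exact Ideal.mul_mem_left _ _ (ih (by rw [APath.length_cons] at h; omega))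

/-- Multiplying by vertex identities on both sides either fixes a path or kills it. -/
theorem corner_mem_pathsLE {s : ℕ} {i j i' j' : V} {x : PathAlgebra k 𝒜}
    (hx : x ∈ pathsLE k 𝒜 s i' j') :
    ofPath k (.nil (1 : 𝒜 j)) * x * ofPath k (.nil (1 : 𝒜 i)) ∈ pathsLE k 𝒜 s i j := by
  induction hx using Submodule.span_induction with
  | mem x h =>
    obtain ⟨p, hp, rfl⟩ := h
    by_cases h1 : j' = j
    · subst h1
      by_cases h2 : i = i'
      · subst h2
        rw [← ofPath_comp, APath.one_comp, ← ofPath_comp, APath.comp_one]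
        exact Submodule.subset_span ⟨p, hp, rfl⟩
      · rw [mul_assoc, ofPath_mul_of_ne k h2, mul_zero]
        exact Submodule.zero_mem _
    · rw [ofPath_mul_of_ne k h1, zero_mul]
      exact Submodule.zero_mem _
  | zero => simp
  | add x y _ _ hx hy => rw [mul_add, add_mul]; exact Submodule.add_mem _ hx hy
  | smul c x _ hx => rw [mul_smul_comm, smul_mul_assoc]; exact Submodule.smul_mem _ _ hx

/-- An ideal containing all `𝒜`-paths of length `s` is generated by its relations of length
at most `s`. -/
theorem ideal_shortRelations {I : Ideal (PathAlgebra k 𝒜)} [I.IsTwoSided] {s : ℕ}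
    (hI : ∀ (i j : V) (p : APath 𝒜 i j), p.length = s → ofPath k p ∈ I) :
    ideal k (shortRelations k I s) = I := by
  have hle : ideal k (shortRelations k I s) ≤ I := ideal_le_iff.2 fun x hx => hx.1
  refine le_antisymm hle fun f hf => ?_
  -- Paths of length at least `s` already lie in the smaller ideal, so only a combination of short
  -- paths, with varying endpoints, is left to treat.
  have hdec : ∀ f : PathAlgebra k 𝒜, ∃ l ∈ ⨆ x : V × V, pathsLE k 𝒜 s x.1 x.2,
      ∃ h ∈ ideal k (shortRelations k I s), f = l + h := by
    intro f
    induction f using PathAlgebra.induction with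
    | h0 => exact ⟨0, Submodule.zero_mem _, 0, Submodule.zero_mem _, by simp⟩
    | hadd f f' hf hf' =>
      obtain ⟨l, hl, h, hh, rfl⟩ := hf
      obtain ⟨l', hl', h', hh', rfl⟩ := hf'
      exact ⟨l + l', add_mem hl hl', h + h', add_mem hh hh', by abel⟩
    | hof c p =>
      rename_i i j
      rcases le_total p.length s with hp | hp
      · exact ⟨c • ofPath k p, Submodule.smul_mem _ _ (Submodule.mem_iSup_of_mem (i, j)
          (Submodule.subset_span ⟨p, hp, rfl⟩)), 0, Submodule.zero_mem _, by simp⟩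
      · refine ⟨0, Submodule.zero_mem _, c • ofPath k p, ?_, by simp⟩
        rw [Algebra.smul_def]
        exact Ideal.mul_mem_left _ _ (ofPath_mem_ideal_shortRelations hI p hp)
  obtain ⟨l, hl, h, hh, rfl⟩ := hdec f
  refine add_mem ?_ hh
  have hlI : l ∈ I := by simpa using sub_mem hf (hle hh)
  have hcorner : ∀ i j : V, ofPath k (.nil (1 : 𝒜 j)) * l * ofPath k (.nil (1 : 𝒜 i)) ∈
      pathsLE k 𝒜 s i j := by
    intro i j
    clear hf hlI
    induction hl using Submodule.iSup_induction' with
    | mem x l hl => exact corner_mem_pathsLE hl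
    | zero => simp
    | add x y _ _ hx hy => rw [mul_add, add_mul]; exact Submodule.add_mem _ hx hy
  -- The identities of the vertices sum to one. Each corner of `l` has fixed endpoints and remains
  -- in `I`, so it is a short relation.
  have hsum : l = ∑ j : V, ∑ i : V,
      ofPath k (.nil (1 : 𝒜 j)) * l * ofPath k (.nil (1 : 𝒜 i)) := by
    simp_rw [← Finset.mul_sum, ← Finset.sum_mul, sum_ofPath_nil_one, one_mul, mul_one]
  rw [hsum]
  exact sum_mem fun j _ => sum_mem fun i _ => subset_ideal _
    ⟨I.mul_mem_right _ (I.mul_mem_left _ hlI), i, j, hcorner i j⟩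

theorem ofPath_mem_J {i j : V} (p : APath 𝒜 i j) (hp : 1 ≤ p.length) : ofPath k p ∈ J k 𝒜 := by
  cases p with
  | nil a => simp [APath.length_nil] at hp
  | cons a β p =>
    rw [ofPath_cons]
    exact Ideal.IsTwoSided.mul_mem_of_left (I := ideal k _) _
      (subset_ideal _ ⟨_, _, _, by simp [APath.length_cons, APath.length_nil], rfl⟩)

/-- Up to the ideal `J`, an element of the path algebra is a sum of entries at the vertices. -/
theorem exists_sub_mem_J (f : PathAlgebra k 𝒜) :
    ∃ a : ∀ i, 𝒜 i, f - ∑ i, ofPath k (.nil (a i)) ∈ J k 𝒜 := by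
  classical
  induction f using PathAlgebra.induction with
  | h0 => exact ⟨0, by simp [ofPath_nil_zero]⟩
  | hadd f f' hf hf' =>
    obtain ⟨a, ha⟩ := hf
    obtain ⟨b, hb⟩ := hf'
    refine ⟨a + b, ?_⟩
    simp_rw [Pi.add_apply, ofPath_nil_add, Finset.sum_add_distrib]
    rw [add_sub_add_comm]
    exact add_mem ha hb
  | hof c p =>
    cases p with
    | nil a =>
      rename_i i
      refine ⟨Pi.single i (c • a), ?_⟩
      rw [Finset.sum_eq_single i, Pi.single_eq_same, ofPath_nil_smul, sub_self]
      · exact Submodule.zero_mem _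
      · intro j _ hj
        rw [Pi.single_eq_of_ne hj, ofPath_nil_zero]
      · simp
    | cons a β p =>
      refine ⟨0, ?_⟩
      simp only [Pi.zero_apply, ofPath_nil_zero, Finset.sum_const_zero, sub_zero]
      rw [Algebra.smul_def]
      exact Ideal.mul_mem_left _ _ (ofPath_mem_J _ (by simp [APath.length_cons]))

end PathAlgebra

/-! ### Decomposition of a semisimple ring into simple components -/

namespace SimpleIdeal

variable {S : Type v} [Ring S] [IsSemisimpleRing S]

theorem one_mul_of_mem (B : SimpleIdeal S) {x : S} (hx : x ∈ B.toIdeal) :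
    (1 : B.Component).1 * x = x :=
  congrArg Subtype.val (one_mul (M := B.Component) ⟨x, hx⟩)

theorem mul_one_of_mem (B : SimpleIdeal S) {x : S} (hx : x ∈ B.toIdeal) :
    x * (1 : B.Component).1 = x :=
  congrArg Subtype.val (mul_one (M := B.Component) ⟨x, hx⟩)

/-- With `e` the identity of `B`, both `e x` and `x e` lie in `B`, so both equal `e x e`. -/
theorem one_val_mul_comm (B : SimpleIdeal S) (x : S) :
    (1 : B.Component).1 * x = x * (1 : B.Component).1 := by
  have := B.isTwoSided
  rw [← B.mul_one_of_mem (B.toIdeal.mul_mem_right x (1 : B.Component).2), mul_assoc,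
    B.one_mul_of_mem (B.toIdeal.mul_mem_left x (1 : B.Component).2)]

omit [IsSemisimpleRing S] in
theorem ext {B C : SimpleIdeal S} (h : B.toIdeal = C.toIdeal) : B = C := by
  obtain ⟨I, _, _, _⟩ := B
  obtain ⟨I', _, _, _⟩ := C
  cases h
  rfl

-- The product lies in the intersection of the two ideals, which is zero by minimality of both.
omit [IsSemisimpleRing S] in
theorem mul_eq_zero_of_ne {B C : SimpleIdeal S} (h : B ≠ C) {x y : S} (hx : x ∈ B.toIdeal)
    (hy : y ∈ C.toIdeal) : x * y = 0 := by
  have := B.isTwoSided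
  have := C.isTwoSided
  have hxy : x * y ∈ B.toIdeal ⊓ C.toIdeal :=
    ⟨B.toIdeal.mul_mem_right y hx, C.toIdeal.mul_mem_left x hy⟩
  have h2 : (B.toIdeal ⊓ C.toIdeal).IsTwoSided :=
    ⟨fun b ha => ⟨B.toIdeal.mul_mem_right b ha.1, C.toIdeal.mul_mem_right b ha.2⟩⟩
  rcases B.minimal _ h2 inf_le_left with h0 | h0
  · rwa [h0, Submodule.mem_bot] at hxy
  · rcases C.minimal _ h2 inf_le_right with h1 | h1
    · rwa [h1, Submodule.mem_bot] at hxy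
    · exact absurd (ext (h0.symm.trans h1)) h

theorem exists_le {I : Ideal S} (hI : I.IsTwoSided) (h0 : I ≠ ⊥) :
    ∃ B : SimpleIdeal S, B.toIdeal ≤ I := by
  obtain ⟨K, ⟨hK, hK0, hKI⟩, hmin⟩ := IsArtinian.set_has_minimal
    {K : Ideal S | K.IsTwoSided ∧ K ≠ ⊥ ∧ K ≤ I} ⟨I, hI, h0, le_rfl⟩
  refine ⟨⟨K, hK, hK0, fun L hL hLK => ?_⟩, hKI⟩
  by_contra! h
  exact hmin L ⟨hL, h.1, hLK.trans hKI⟩ (lt_of_le_of_ne hLK h.2)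

/-- The sum `e` is a central idempotent, so its annihilator is a two-sided ideal. If nonzero, it
would contain some simple ideal `B`, yet multiplication by `e` fixes the identity of `B`. Hence the
annihilator is zero, and it contains `1 - e`. -/
theorem sum_one [Fintype (SimpleIdeal S)] : ∑ B : SimpleIdeal S, (1 : B.Component).1 = 1 := by
  classical
  set e : S := ∑ B : SimpleIdeal S, (1 : B.Component).1 with he
  have hcomm : ∀ x, e * x = x * e := fun x => by
    rw [he, Finset.sum_mul, Finset.mul_sum]
    exact Finset.sum_congr rfl fun B _ => B.one_val_mul_comm x
  have hid : ∀ B : SimpleIdeal S, (1 : B.Component).1 * e = (1 : B.Component).1 := fun B => by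
    rw [he, Finset.mul_sum, Finset.sum_eq_single B, B.one_mul_of_mem (1 : B.Component).2]
    · exact fun C _ hC => mul_eq_zero_of_ne hC.symm (1 : B.Component).2 (1 : C.Component).2
    · simp
  let I : Ideal S :=
    { carrier := {x | x * e = 0}
      zero_mem' := zero_mul e
      add_mem' := fun {a b} ha hb => by
        change (a + b) * e = 0
        rw [add_mul, show a * e = 0 from ha, show b * e = 0 from hb, add_zero]
      smul_mem' := fun c x hx => by
        change c * x * e = 0
        rw [mul_assoc, show x * e = 0 from hx, mul_zero] }
  have hI : I.IsTwoSided := ⟨fun {a} b ha => by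
    change a * b * e = 0
    rw [mul_assoc, ← hcomm, ← mul_assoc, show a * e = 0 from ha, zero_mul]⟩
  have hI0 : I = ⊥ := by
    by_contra h
    obtain ⟨B, hB⟩ := exists_le hI h
    have h1 : (1 : B.Component).1 = 0 := (hid B).symm.trans (hB (1 : B.Component).2)
    refine B.ne_bot ((Submodule.eq_bot_iff _).2 fun x hx => ?_)
    rw [← B.one_mul_of_mem hx, h1, zero_mul]
  have hee : e * e = e := by
    conv_lhs => rw [he, Finset.sum_mul]
    exact Finset.sum_congr rfl fun B _ => hid B
  have h1 : 1 - e ∈ I := by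
    change (1 - e) * e = 0
    rw [sub_mul, one_mul, hee, sub_self]
  rw [hI0, Submodule.mem_bot, sub_eq_zero] at h1
  exact h1.symm

/-- An ideal of the ring `B` is also a two-sided ideal of `S`: multiplying an element of `B` by `c`
amounts to multiplying it by `c` times the identity of `B`, which lies in `B`. Minimality of `B`
then applies. -/
instance (B : SimpleIdeal S) : IsSimpleRing B.Component := by
  have := B.isTwoSided
  have hnt : Nontrivial B.Component := Submodule.nontrivial_iff_ne_bot.2 B.ne_bot
  refine ⟨⟨fun I => ?_⟩⟩
  let K : Ideal S :=
    { carrier := {x | ∃ y ∈ I, y.1 = x}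
      zero_mem' := ⟨0, I.zero_mem, rfl⟩
      add_mem' := by
        rintro _ _ ⟨a, ha, rfl⟩ ⟨b, hb, rfl⟩
        exact ⟨a + b, I.add_mem ha hb, rfl⟩
      smul_mem' := by
        rintro c _ ⟨y, hy, rfl⟩
        refine ⟨⟨c * (1 : B.Component).1, B.toIdeal.mul_mem_left c (1 : B.Component).2⟩ * y,
          I.mul_mem_left _ _ hy, ?_⟩
        change c * (1 : B.Component).1 * y.1 = c * y.1
        rw [mul_assoc, B.one_mul_of_mem y.2] }
  have hK : K.IsTwoSided := ⟨by
    rintro _ c ⟨y, hy, rfl⟩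
    refine ⟨y * ⟨(1 : B.Component).1 * c, B.toIdeal.mul_mem_right c (1 : B.Component).2⟩,
      I.mul_mem_right _ _ hy, ?_⟩
    change y.1 * ((1 : B.Component).1 * c) = y.1 * c
    rw [← mul_assoc, B.mul_one_of_mem y.2]⟩
  have hKB : K ≤ B.toIdeal := by
    rintro _ ⟨y, -, rfl⟩
    exact y.2
  rcases B.minimal K hK hKB with h | h
  · left
    rw [eq_bot_iff]
    intro y hy
    have : y.1 ∈ K := ⟨y, hy, rfl⟩
    rw [h, Submodule.mem_bot] at this
    exact (TwoSidedIdeal.mem_bot _).2 (Subtype.ext this)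
  · right
    rw [eq_top_iff]
    intro y _
    have : y.1 ∈ K := by rw [h]; exact y.2
    obtain ⟨z, hz, hzy⟩ := this
    rwa [← (Subtype.ext hzy : z = y)]

end SimpleIdeal

/-! ### The degree filtration and the radical -/

section Graded

open DirectSum

variable {k : Type u} {A : Type v} [Field k] [Ring A] [Algebra k A] (𝒢 : ℕ → Submodule k A)
  [GradedAlgebra 𝒢]

theorem coe_decompose_mul_eq_zero {m n : ℕ} {x y : A}
    (hx : ∀ i < m, (decompose 𝒢 x i : A) = 0) (hy : ∀ i < n, (decompose 𝒢 y i : A) = 0)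
    {i : ℕ} (hi : i < m + n) : (decompose 𝒢 (x * y) i : A) = 0 := by
  rw [decompose_mul, coe_mul_apply_eq_sum_antidiagonal]
  refine Finset.sum_eq_zero fun ab hab => ?_
  rw [Finset.HasAntidiagonal.mem_antidiagonal] at hab
  rcases lt_or_ge ab.1 m with h | h
  · rw [hx _ h, zero_mul]
  · rw [hy _ (by omega), mul_zero]

/-- The ideal of the elements whose components of degree less than `n` vanish. -/
def degreeGE (n : ℕ) : Ideal A where
  carrier := {x | ∀ i < n, (decompose 𝒢 x i : A) = 0}
  zero_mem' := by simp
  add_mem' := fun {a b} ha hb i hi => by simp [ha i hi, hb i hi]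
  smul_mem' := fun c x hx i hi =>
    -- Lower bound zero on the degree imposes no condition on the factor `c`.
    coe_decompose_mul_eq_zero 𝒢 (m := 0) (by simp) hx (by simpa using hi)

variable {𝒢}

theorem mul_mem_degreeGE {m n : ℕ} {x y : A} (hx : x ∈ degreeGE 𝒢 m) (hy : y ∈ degreeGE 𝒢 n) :
    x * y ∈ degreeGE 𝒢 (m + n) :=
  fun _ hi => coe_decompose_mul_eq_zero 𝒢 hx hy hi

instance (n : ℕ) : (degreeGE 𝒢 n).IsTwoSided :=
  ⟨fun b ha => mul_mem_degreeGE ha (fun i hi => absurd hi (by simp) : b ∈ degreeGE 𝒢 0)⟩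

theorem mem_degreeGE_of_mem {m n : ℕ} (h : m ≤ n) {x : A} (hx : x ∈ 𝒢 n) : x ∈ degreeGE 𝒢 m :=
  fun _ hi => decompose_of_mem_ne 𝒢 hx (by omega)

theorem degreeGE_mono {m n : ℕ} (h : m ≤ n) : degreeGE 𝒢 n ≤ degreeGE 𝒢 m :=
  fun _ hx i hi => hx i (by omega)

theorem mem_of_component_mem {n : ℕ} {x : A} (hx : x ∈ degreeGE 𝒢 n) (P : AddSubmonoid A)
    (h : ∀ i, n ≤ i → (decompose 𝒢 x i : A) ∈ P) : x ∈ P := by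
  classical
  rw [← sum_support_decompose 𝒢 x]
  refine sum_mem fun i _ => ?_
  rcases lt_or_ge i n with hi | hi
  · rw [hx i hi]; exact P.zero_mem
  · exact h i hi

/-- Used for `n = 0` to split `A` over `A/r`, and for `n = 1` to replace elements of `r` by
homogeneous ones modulo `r²`. -/
theorem sub_component_mem_degreeGE {n : ℕ} {x : A} (hx : x ∈ degreeGE 𝒢 n) :
    x - (decompose 𝒢 x n : A) ∈ degreeGE 𝒢 (n + 1) := by
  intro i hi
  rw [decompose_sub, DirectSum.sub_apply, AddSubgroupClass.coe_sub]
  rcases Nat.lt_succ_iff_lt_or_eq.1 hi with h | rfl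
  · rw [hx i h, decompose_of_mem_ne 𝒢 (SetLike.coe_mem _) h.ne', sub_zero]
  · rw [decompose_of_mem_same 𝒢 (SetLike.coe_mem _), sub_self]

theorem eq_zero_of_mem_of_mem_degreeGE {m n : ℕ} (h : m < n) {x : A} (hx : x ∈ 𝒢 m)
    (hx' : x ∈ degreeGE 𝒢 n) : x = 0 := by
  rw [← decompose_of_mem_same 𝒢 hx, hx' m h]

-- The descending chain of these ideals stabilizes. An element of the stable term has order
-- exceeding every degree, so all its components vanish.
variable (𝒢) in
theorem exists_degreeGE_eq_bot [IsArtinianRing A] : ∃ s, 0 < s ∧ degreeGE 𝒢 s = ⊥ := by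
  obtain ⟨n, hn⟩ := IsArtinian.monotone_stabilizes
    (⟨fun n => OrderDual.toDual (degreeGE 𝒢 n), fun _ _ h => degreeGE_mono h⟩ :
      ℕ →o (Ideal A)ᵒᵈ)
  have hn' : ∀ m, n ≤ m → degreeGE 𝒢 n = degreeGE 𝒢 m := fun m h => hn m h
  -- `n + 1` instead of `n` guarantees a positive exponent.
  refine ⟨n + 1, n.succ_pos, (Submodule.eq_bot_iff _).2 fun x hx => ?_⟩
  refine mem_of_component_mem hx ⊥ fun i hi => ?_
  have h1 : x ∈ degreeGE 𝒢 (i + 1) := by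
    rw [← hn' (i + 1) (by omega)]
    exact degreeGE_mono n.le_succ hx
  exact h1 i i.lt_succ_self

theorem pow_mem_degreeGE {x : A} (hx : x ∈ degreeGE 𝒢 1) (n : ℕ) : x ^ n ∈ degreeGE 𝒢 n := by
  induction n with
  | zero => exact fun i hi => absurd hi (by simp)
  | succ n ih => rw [pow_succ]; exact mul_mem_degreeGE ih hx

variable (𝒢) in
/-- The radical of a graded artinian ring with semisimple part of degree zero. -/
theorem jacobson_eq_degreeGE [IsArtinianRing A] [IsSemisimpleRing (𝒢 0)] :
    Ring.jacobson A = degreeGE 𝒢 1 := by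
  apply le_antisymm
  · intro x hx
    -- A surjective homomorphism carries the radical into the radical, and that of the semisimple
    -- degree zero part is zero.
    have : RingHomSurjective (GradedRing.projZeroRingHom' 𝒢) :=
      ⟨GradedRing.projZeroRingHom'_surjective 𝒢⟩
    have h := Ring.le_comap_jacobson (GradedRing.projZeroRingHom' 𝒢) hx
    rw [IsSemisimpleRing.jacobson_eq_bot, Ideal.mem_comap, Submodule.mem_bot] at h
    intro i hi
    obtain rfl : i = 0 := by omega
    exact congrArg Subtype.val h
  · obtain ⟨s, -, hs⟩ := exists_degreeGE_eq_bot 𝒢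
    rw [Ring.jacobson_eq_sInf_isMaximal]
    refine le_sInf fun m hm x hx => ?_
    by_contra hxm
    -- If `x` were outside the maximal left ideal `m`, some `z = 1 - y x` would lie in `m`. But `y
    -- x` has positive order, hence is nilpotent, and `z` is a unit.
    obtain ⟨y, z, hz, hyz⟩ := Ideal.IsMaximal.exists_inv hm hxm
    have hnil : IsNilpotent (y * x) := ⟨s, by
      have := pow_mem_degreeGE (Ideal.mul_mem_left _ y hx) s
      rwa [hs, Submodule.mem_bot] at this⟩
    have hu : IsUnit z := by
      rw [← eq_sub_iff_add_eq'] at hyz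
      rw [hyz]
      exact hnil.isUnit_one_sub
    exact hm.ne_top (Ideal.eq_top_of_isUnit_mem _ hz hu)

-- Strictness is what gives the inclusion from right to left: a component of degree `i ≥ 2` is a sum
-- of products of elements of degrees `1` and `i - 1`, both positive.
variable (𝒢) in
theorem jacobson_sq_eq_degreeGE [IsArtinianRing A] [IsSemisimpleRing (𝒢 0)]
    (h𝒢 : ∀ i j, 𝒢 i * 𝒢 j = 𝒢 (i + j)) : Ring.jacobson A ^ 2 = degreeGE 𝒢 2 := by
  rw [jacobson_eq_degreeGE 𝒢, Submodule.pow_succ, Submodule.pow_one]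
  apply le_antisymm
  · exact Ideal.mul_le.2 fun x hx y hy => mul_mem_degreeGE hx hy
  · intro x hx
    refine mem_of_component_mem hx (degreeGE 𝒢 1 * degreeGE 𝒢 1).toAddSubmonoid fun i hi => ?_
    obtain ⟨j, rfl⟩ : ∃ j, i = 1 + (1 + j) := ⟨i - 2, by omega⟩
    have hmem : (decompose 𝒢 x (1 + (1 + j)) : A) ∈ 𝒢 1 * 𝒢 (1 + j) :=
      (h𝒢 1 (1 + j)).symm ▸ SetLike.coe_mem (decompose 𝒢 x (1 + (1 + j)))
    generalize (decompose 𝒢 x (1 + (1 + j)) : A) = y at hmem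
    induction hmem using Submodule.mul_induction_on' with
    | mem_mul_mem a ha b hb =>
      exact Ideal.mul_mem_mul (mem_degreeGE_of_mem le_rfl ha) (mem_degreeGE_of_mem (by omega) hb)
    | add a _ b _ ha hb => exact add_mem ha hb

end Graded

/-! ### The bimodules of the natural quiver and their generators -/

section Sandwich

variable {A : Type v} [Ring A]

theorem mk_sq_mul_eq_of_left {a a' x : A} (hx : x ∈ Ring.jacobson A)
    (h : Ideal.Quotient.mk (Ring.jacobson A) a = Ideal.Quotient.mk (Ring.jacobson A) a') :
    Ideal.Quotient.mk (Ring.jacobson A ^ 2) (a * x) =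
      Ideal.Quotient.mk (Ring.jacobson A ^ 2) (a' * x) := by
  rw [Ideal.Quotient.eq] at h ⊢
  rw [← sub_mul, Submodule.pow_succ, Submodule.pow_one]
  exact Ideal.mul_mem_mul h hx

theorem mk_sq_mul_eq_of_right {b b' x : A} (hx : x ∈ Ring.jacobson A)
    (h : Ideal.Quotient.mk (Ring.jacobson A) b = Ideal.Quotient.mk (Ring.jacobson A) b') :
    Ideal.Quotient.mk (Ring.jacobson A ^ 2) (x * b) =
      Ideal.Quotient.mk (Ring.jacobson A ^ 2) (x * b') := by
  rw [Ideal.Quotient.eq] at h ⊢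
  rw [← mul_sub, Submodule.pow_succ, Submodule.pow_one]
  exact Ideal.mul_mem_mul hx h

/-- This is the well-definedness of the `A/r`-bimodule structure on `r/r²`: changing an outer factor
by an element of `r` changes the product by an element of `r²`. -/
theorem mk_sq_mul_mul_eq {a a' x x' b b' : A} (hx : x ∈ Ring.jacobson A)
    (ha : Ideal.Quotient.mk (Ring.jacobson A) a = Ideal.Quotient.mk (Ring.jacobson A) a')
    (hxx' : Ideal.Quotient.mk (Ring.jacobson A ^ 2) x = Ideal.Quotient.mk (Ring.jacobson A ^ 2) x')
    (hb : Ideal.Quotient.mk (Ring.jacobson A) b = Ideal.Quotient.mk (Ring.jacobson A) b') :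
    Ideal.Quotient.mk (Ring.jacobson A ^ 2) (a * x * b) =
      Ideal.Quotient.mk (Ring.jacobson A ^ 2) (a' * x' * b') := by
  rw [mk_sq_mul_eq_of_right (Ideal.mul_mem_left _ a hx) hb, map_mul, mk_sq_mul_eq_of_left hx ha,
    map_mul, hxx', ← map_mul, ← map_mul]

theorem sq_jacobson_le : Ring.jacobson A ^ 2 ≤ Ring.jacobson A := by
  rw [Submodule.pow_succ, Submodule.pow_one]
  exact Ideal.mul_le.2 fun x _ y hy => Ideal.mul_mem_left _ x hy

theorem sandwich_mono {j i : NaturalQuiver A} {X Y : Set (A ⧸ Ring.jacobson A ^ 2)}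
    (h : X ⊆ Y) : sandwich j i X ≤ sandwich j i Y :=
  AddSubgroup.closure_mono fun _ ⟨a, x, b, ha, hx, hb, e⟩ => ⟨a, x, b, ha, h hx, hb, e⟩

theorem mem_jacobson_of_mk_sq_mem {x : A} (hx : Ideal.Quotient.mk (Ring.jacobson A ^ 2) x ∈
    Ideal.Quotient.mk (Ring.jacobson A ^ 2) '' (Ring.jacobson A : Set A)) :
    x ∈ Ring.jacobson A := by
  obtain ⟨y, hy, hxy⟩ := hx
  rw [Ideal.Quotient.eq] at hxy
  simpa using sub_mem hy (sq_jacobson_le hxy)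

theorem exists_lift_of_mem_natBimodule {j i : NaturalQuiver A} {z : A ⧸ Ring.jacobson A ^ 2}
    (hz : z ∈ natBimodule j i) :
    ∃ x ∈ Ring.jacobson A, Ideal.Quotient.mk (Ring.jacobson A ^ 2) x = z := by
  induction hz using AddSubgroup.closure_induction with
  | mem z h =>
    obtain ⟨a, x, b, -, hx, -, rfl⟩ := h
    exact ⟨_, Ideal.mul_mem_right _ _ (Ideal.mul_mem_left _ _ (mem_jacobson_of_mk_sq_mem hx)), rfl⟩
  | zero => exact ⟨0, zero_mem _, map_zero _⟩
  | add _ _ _ _ h h' =>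
    obtain ⟨x, hx, rfl⟩ := h
    obtain ⟨x', hx', rfl⟩ := h'
    exact ⟨x + x', add_mem hx hx', map_add _ _ _⟩
  | neg _ _ h =>
    obtain ⟨x, hx, rfl⟩ := h
    exact ⟨-x, neg_mem hx, map_neg _ _⟩

/-- `Ā_j · X · Ā_i` as a left submodule of `A/r²`. -/
def sandwichSubmodule (j i : NaturalQuiver A) (X : Set (A ⧸ Ring.jacobson A ^ 2)) :
    Submodule A (A ⧸ Ring.jacobson A ^ 2) where
  __ := sandwich j i X
  smul_mem' := fun c z hz => by
    change c • z ∈ sandwich j i X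
    change z ∈ sandwich j i X at hz
    induction hz using AddSubgroup.closure_induction with
    | mem z h =>
      obtain ⟨a, x, b, ha, hx, hb, rfl⟩ := h
      refine AddSubgroup.subset_closure ⟨c * a, x, b, ?_, hx, hb, ?_⟩
      · rw [map_mul]
        exact Ideal.mul_mem_left _ _ ha
      · simp only [mul_assoc]
        rfl
    | zero => rw [smul_zero]; exact zero_mem _
    | add _ _ _ _ h h' => rw [smul_add]; exact add_mem h h'
    | neg _ _ h => rw [smul_neg]; exact neg_mem h

variable [IsArtinianRing A]

theorem mem_sandwich_of_mem_natBimodule {j i : NaturalQuiver A}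
    {X : Set (A ⧸ Ring.jacobson A ^ 2)} (hX : X ⊆ natBimodule j i) : X ⊆ sandwich j i X := by
  intro z hz
  obtain ⟨a, ha⟩ := Ideal.Quotient.mk_surjective (1 : j.simpleIdeal.Component).1
  obtain ⟨b, hb⟩ := Ideal.Quotient.mk_surjective (1 : i.simpleIdeal.Component).1
  -- Lifts of the identities of the two components act as identities on the bimodule, so each `z` in
  -- `X` is itself a sandwiched product.
  have key : ∀ z ∈ natBimodule j i, Ideal.Quotient.mk (Ring.jacobson A ^ 2) a * z *
      Ideal.Quotient.mk (Ring.jacobson A ^ 2) b = z := by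
    intro z hz
    induction hz using AddSubgroup.closure_induction with
    | mem z h =>
      obtain ⟨a', x, b', ha', hx, hb', rfl⟩ := h
      have hx' := mem_jacobson_of_mk_sq_mem hx
      rw [← map_mul, ← map_mul, show a * (a' * x * b') * b = (a * a') * x * (b' * b) by
        simp only [mul_assoc]]
      refine mk_sq_mul_mul_eq hx' ?_ rfl ?_
      · rw [map_mul, ha, SimpleIdeal.one_mul_of_mem _ ha']
      · rw [map_mul, hb, SimpleIdeal.mul_one_of_mem _ hb']
    | zero => simp
    | add _ _ _ _ h h' => rw [mul_add, add_mul, h, h']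
    | neg _ _ h => rw [mul_neg, neg_mul, h]
  obtain ⟨x, rfl⟩ := Ideal.Quotient.mk_surjective z
  refine AddSubgroup.subset_closure ⟨a, x, b, ?_, hz, ?_, ?_⟩
  · rw [ha]; exact (1 : j.simpleIdeal.Component).2
  · rw [hb]; exact (1 : i.simpleIdeal.Component).2
  · rw [map_mul, map_mul, key _ (hX hz)]

/-- The rank of `ⱼMᵢ` is attained by a finite generating set. -/
theorem exists_generators_card_eq_natRank (j i : NaturalQuiver A) :
    ∃ X : Finset (A ⧸ Ring.jacobson A ^ 2), X.card = natRank j i ∧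
      (X : Set (A ⧸ Ring.jacobson A ^ 2)) ⊆ natBimodule j i ∧
      sandwich j i (X : Set (A ⧸ Ring.jacobson A ^ 2)) = natBimodule j i := by
  -- The infimum of the empty set would be the junk value `0`, so a finite generating set must be
  -- shown to exist. A left artinian ring is left noetherian, so the bimodule is finitely generated
  -- already as a left module.
  refine Nat.sInf_mem (s := {n | ∃ X : Finset (A ⧸ Ring.jacobson A ^ 2),
    X.card = n ∧ (X : Set (A ⧸ Ring.jacobson A ^ 2)) ⊆ natBimodule j i ∧
      sandwich j i (X : Set (A ⧸ Ring.jacobson A ^ 2)) = natBimodule j i}) ?_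
  let N := sandwichSubmodule j i
    (Ideal.Quotient.mk (Ring.jacobson A ^ 2) '' (Ring.jacobson A : Set A))
  obtain ⟨X, hX⟩ := (IsNoetherian.noetherian N : N.FG)
  have hXN : (X : Set (A ⧸ Ring.jacobson A ^ 2)) ⊆ natBimodule j i := fun x hx => by
    have : x ∈ N := hX ▸ Submodule.subset_span hx
    exact this
  refine ⟨X.card, X, rfl, hXN, le_antisymm (sandwich_mono fun z hz => ?_) fun z hz => ?_⟩
  · exact exists_lift_of_mem_natBimodule (hXN hz)
  · have h1 : Submodule.span A (X : Set (A ⧸ Ring.jacobson A ^ 2)) ≤ sandwichSubmodule j i X :=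
      Submodule.span_le.2 (mem_sandwich_of_mem_natBimodule hXN)
    rw [hX] at h1
    exact h1 hz

end Sandwich

/-! ### The presentation map onto a radical-graded algebra -/

section Presentation

open DirectSum

variable {k : Type u} {A : Type v} [Field k] [Ring A] [Algebra k A] (𝒢 : ℕ → Submodule k A)
  [GradedAlgebra 𝒢] [IsArtinianRing A] [IsSemisimpleRing (𝒢 0)]

/-- The section `A/r → A` whose image is the part of degree zero. -/
def degreeZeroSection : A ⧸ Ring.jacobson A →ₐ[k] A :=
  Ideal.Quotient.liftₐ (Ring.jacobson A)
    { GradedRing.projZeroRingHom 𝒢 with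
      commutes' := fun c => decompose_of_mem_same 𝒢 (SetLike.algebraMap_mem_graded 𝒢 c) }
    fun a ha => by
      rw [jacobson_eq_degreeGE 𝒢] at ha
      exact ha 0 zero_lt_one

theorem degreeZeroSection_mk (a : A) :
    degreeZeroSection 𝒢 (Ideal.Quotient.mk _ a) = decompose 𝒢 a 0 := rfl

theorem degreeZeroSection_mem (z : A ⧸ Ring.jacobson A) : degreeZeroSection 𝒢 z ∈ 𝒢 0 := by
  obtain ⟨a, rfl⟩ := Ideal.Quotient.mk_surjective z
  exact SetLike.coe_mem _

theorem mk_degreeZeroSection (z : A ⧸ Ring.jacobson A) :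
    Ideal.Quotient.mk (Ring.jacobson A) (degreeZeroSection 𝒢 z) = z := by
  obtain ⟨a, rfl⟩ := Ideal.Quotient.mk_surjective z
  rw [degreeZeroSection_mk, eq_comm, Ideal.Quotient.eq, jacobson_eq_degreeGE 𝒢]
  exact sub_component_mem_degreeGE fun i hi => absurd hi (by simp)

/-- The inclusion of the algebra at a vertex into the degree zero part of `A`. -/
def vertexMap (i : NaturalQuiver A) : vertexAlgebra A i →ₗ[k] A :=
  (degreeZeroSection 𝒢).toLinearMap ∘ₗ
    (i.simpleIdeal.toIdeal.subtype.restrictScalars k : i.simpleIdeal.toIdeal →ₗ[k] _)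

theorem isOrthogonalSystem_vertexMap : IsOrthogonalSystem (vertexMap 𝒢) where
  map_mul i a b := map_mul (degreeZeroSection 𝒢) (Subtype.val a) (Subtype.val b)
  orthogonal i j hij a b := by
    refine (map_mul (degreeZeroSection 𝒢) (Subtype.val a) (Subtype.val b)).symm.trans ?_
    rw [SimpleIdeal.mul_eq_zero_of_ne hij (Subtype.property a) (Subtype.property b), map_zero]
  sum_one := by
    let _ : Fintype (SimpleIdeal (A ⧸ Ring.jacobson A)) :=
      inferInstanceAs (Fintype (NaturalQuiver A))
    have h := congrArg (degreeZeroSection 𝒢)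
      (SimpleIdeal.sum_one (S := A ⧸ Ring.jacobson A))
    rw [map_sum, map_one] at h
    exact h

/-- Generators of degree one for the arrows of the natural quiver. -/
theorem exists_arrow_lift (h𝒢 : ∀ i j, 𝒢 i * 𝒢 j = 𝒢 (i + j)) (j i : NaturalQuiver A) :
    ∃ g : Fin (natRank j i) → A, (∀ n, g n ∈ 𝒢 1) ∧
      sandwich j i (Set.range fun n => Ideal.Quotient.mk (Ring.jacobson A ^ 2) (g n)) =
        natBimodule j i := by
  obtain ⟨X, hcard, hXN, hX⟩ := exists_generators_card_eq_natRank j i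
  have hlift : ∀ x : X, ∃ y ∈ 𝒢 1, Ideal.Quotient.mk (Ring.jacobson A ^ 2) y = x := by
    intro x
    obtain ⟨y, hy, hyx⟩ := exists_lift_of_mem_natBimodule (hXN x.2)
    -- A lift in `r` differs from its degree one component by terms of degree at least two, which
    -- lie in `r²`.
    refine ⟨decompose 𝒢 y 1, SetLike.coe_mem _, ?_⟩
    rw [← hyx, eq_comm, Ideal.Quotient.eq, jacobson_sq_eq_degreeGE 𝒢 h𝒢]
    rw [jacobson_eq_degreeGE 𝒢] at hy
    exact sub_component_mem_degreeGE hy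
  choose f hf hfx using hlift
  refine ⟨fun n => f ((X.equivFinOfCardEq hcard).symm n), fun n => hf _, ?_⟩
  rw [← hX]
  congr 1
  ext x
  simp only [hfx, Set.mem_range, Finset.mem_coe]
  constructor
  · rintro ⟨n, rfl⟩
    exact Subtype.property _
  · intro hx
    exact ⟨X.equivFinOfCardEq hcard ⟨x, hx⟩, by simp⟩

variable {𝒢} {g : ∀ ⦃i j : NaturalQuiver A⦄, (i ⟶ j) → A}
  (hg : ∀ ⦃i j : NaturalQuiver A⦄ (β : i ⟶ j), g β ∈ 𝒢 1)

include hg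

/-- Every arrow raises the order by one and the entries do not lower it. -/
theorem eval_mem_degreeGE {i j : NaturalQuiver A} (p : APath (vertexAlgebra A) i j) :
    p.eval (vertexMap 𝒢) g ∈ degreeGE 𝒢 p.length := by
  induction p with
  | nil a => exact fun i hi => absurd hi (by simp [APath.length_nil])
  | cons a β p ih =>
    rw [APath.length_cons, add_comm]
    exact mul_mem_degreeGE (Ideal.mul_mem_left _ _ (mem_degreeGE_of_mem le_rfl (hg β))) ih

theorem J_le_comap_degreeGE : PathAlgebra.J k (vertexAlgebra A) ≤
    (degreeGE 𝒢 1).comap (PathAlgebra.evalHom (isOrthogonalSystem_vertexMap 𝒢) g) := by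
  refine PathAlgebra.ideal_le_iff.2 ?_
  rintro _ ⟨i, j, p, hp, rfl⟩
  rw [SetLike.mem_coe, Ideal.mem_comap, PathAlgebra.evalHom_ofPath, ← hp]
  exact eval_mem_degreeGE hg p

theorem J_pow_le_comap_degreeGE (n : ℕ) : PathAlgebra.J k (vertexAlgebra A) ^ n ≤
    (degreeGE 𝒢 n).comap (PathAlgebra.evalHom (isOrthogonalSystem_vertexMap 𝒢) g) := by
  induction n with
  | zero => exact fun x _ i hi => absurd hi (by simp)
  | succ n ih =>
    rw [Submodule.pow_succ]
    refine Ideal.mul_le.2 fun x hx y hy => ?_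
    rw [Ideal.mem_comap, map_mul]
    exact mul_mem_degreeGE (ih hx) (J_le_comap_degreeGE hg hy)

/-- Modulo `J`, an element `f` is a sum of entries `a i` at the vertices. Since `J` is sent into
`r`, the image of `f` in `A/r` is the sum of the `a i`; if it is zero, every `a i` is zero because
the simple components are independent. -/
theorem ker_evalHom_le_J :
    RingHom.ker (PathAlgebra.evalHom (k := k) (isOrthogonalSystem_vertexMap 𝒢) g) ≤
      PathAlgebra.J k (vertexAlgebra A) := by
  intro f hf
  obtain ⟨a, ha⟩ := PathAlgebra.exists_sub_mem_J f
  have h1 := J_le_comap_degreeGE hg ha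
  rw [Ideal.mem_comap, map_sub, (RingHom.mem_ker).1 hf, zero_sub, neg_mem_iff,
    ← jacobson_eq_degreeGE 𝒢, ← Ideal.Quotient.eq_zero_iff_mem, map_sum, map_sum] at h1
  simp only [PathAlgebra.evalHom_ofPath, APath.eval] at h1
  have h2 : ∑ i : NaturalQuiver A, (Subtype.val (a i) : A ⧸ Ring.jacobson A) = 0 := by
    rw [← h1]
    exact Finset.sum_congr rfl fun i _ => (mk_degreeZeroSection 𝒢 _).symm
  have h3 : ∀ i, a i = 0 := fun i => by
    -- Multiplication by the identity of the `i`-th component isolates `a i`.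
    have h4 := congrArg ((1 : i.simpleIdeal.Component).1 * ·) h2
    simp only [mul_zero] at h4
    rw [Finset.mul_sum, Finset.sum_eq_single i,
      SimpleIdeal.one_mul_of_mem _ (Subtype.property (a i))] at h4
    · exact Subtype.ext h4
    · exact fun j _ hj => SimpleIdeal.mul_eq_zero_of_ne hj.symm
        (1 : i.simpleIdeal.Component).2 (Subtype.property (a j))
    · simp
  simpa [h3, PathAlgebra.ofPath_nil_zero] using ha

theorem evalHom_surjective (h𝒢 : ∀ i j, 𝒢 i * 𝒢 j = 𝒢 (i + j))
    (hgen : ∀ j i : NaturalQuiver A,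
      sandwich j i (Set.range fun β : i ⟶ j => Ideal.Quotient.mk (Ring.jacobson A ^ 2) (g β)) =
        natBimodule j i) :
    Function.Surjective (PathAlgebra.evalHom (isOrthogonalSystem_vertexMap 𝒢) g) := by
  set φ := PathAlgebra.evalHom (isOrthogonalSystem_vertexMap 𝒢) g with hφ
  have hone := (isOrthogonalSystem_vertexMap 𝒢).sum_one
  have hpath : ∀ {i j : NaturalQuiver A} (p : APath (vertexAlgebra A) i j),
      p.eval (vertexMap 𝒢) g ∈ φ.range := fun p =>
    ⟨PathAlgebra.ofPath k p, PathAlgebra.evalHom_ofPath _ g p⟩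
  -- An element of degree zero is the sum of its products with the vertex identities, each of which
  -- is the value of a path of length zero.
  have h0 : ∀ x ∈ 𝒢 0, x ∈ φ.range := by
    intro x hx
    have hx' : degreeZeroSection 𝒢 (Ideal.Quotient.mk _ x) = x := by
      rw [degreeZeroSection_mk, decompose_of_mem_same 𝒢 hx]
    rw [← mul_one x, ← hone, Finset.mul_sum]
    refine sum_mem fun i _ => ?_
    have h := hpath (.nil (i := i) (⟨Ideal.Quotient.mk _ x * (1 : i.simpleIdeal.Component).1,
      Ideal.mul_mem_left _ _ (1 : i.simpleIdeal.Component).2⟩ : i.simpleIdeal.toIdeal))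
    have e : x * vertexMap 𝒢 i 1 = degreeZeroSection 𝒢
        (Ideal.Quotient.mk _ x * (1 : i.simpleIdeal.Component).1) := by
      rw [map_mul, hx']
      rfl
    rw [e]
    exact h
  -- The lift has to be homogeneous of degree one, not merely in the range: this is what later turns
  -- a congruence modulo `r²` into an equality.
  have hsand : ∀ (j i : NaturalQuiver A), ∀ z ∈ natBimodule j i, ∃ w ∈ φ.range, w ∈ 𝒢 1 ∧
      Ideal.Quotient.mk (Ring.jacobson A ^ 2) w = z := by
    intro j i z hz
    rw [← hgen] at hz
    induction hz using AddSubgroup.closure_induction with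
    | mem z h =>
      obtain ⟨a, x, b, ha, ⟨β, hβ⟩, hb, rfl⟩ := h
      refine ⟨degreeZeroSection 𝒢 (Ideal.Quotient.mk _ a) * g β *
          degreeZeroSection 𝒢 (Ideal.Quotient.mk _ b),
        hpath (.cons (⟨_, ha⟩ : j.simpleIdeal.toIdeal) β
          (.nil (⟨_, hb⟩ : i.simpleIdeal.toIdeal))), ?_, ?_⟩
      · exact SetLike.mul_mem_graded (i := 0 + 1) (j := 0) (SetLike.mul_mem_graded
          (degreeZeroSection_mem 𝒢 _) (hg β)) (degreeZeroSection_mem 𝒢 _)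
      · refine mk_sq_mul_mul_eq ?_ (mk_degreeZeroSection 𝒢 _) hβ (mk_degreeZeroSection 𝒢 _)
        rw [jacobson_eq_degreeGE 𝒢]
        exact mem_degreeGE_of_mem le_rfl (hg β)
    | zero => exact ⟨0, zero_mem _, zero_mem _, map_zero _⟩
    | add _ _ _ _ h h' =>
      obtain ⟨x, hx, hx1, rfl⟩ := h
      obtain ⟨x', hx', hx1', rfl⟩ := h'
      exact ⟨x + x', add_mem hx hx', add_mem hx1 hx1', map_add _ _ _⟩
    | neg _ _ h =>
      obtain ⟨x, hx, hx1, rfl⟩ := h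
      exact ⟨-x, neg_mem hx, neg_mem hx1, map_neg _ _⟩
  have h1 : ∀ x ∈ 𝒢 1, x ∈ φ.range := by
    intro x hx
    have hsum : x = ∑ j, ∑ i, vertexMap 𝒢 j 1 * x * vertexMap 𝒢 i 1 := by
      simp_rw [← Finset.mul_sum, ← Finset.sum_mul, hone, one_mul, mul_one]
    rw [hsum]
    refine sum_mem fun j _ => sum_mem fun i _ => ?_
    have hxr : x ∈ Ring.jacobson A := by
      rw [jacobson_eq_degreeGE 𝒢]
      exact mem_degreeGE_of_mem le_rfl hx
    have hdeg : vertexMap 𝒢 j 1 * x * vertexMap 𝒢 i 1 ∈ 𝒢 1 :=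
      SetLike.mul_mem_graded (i := 0 + 1) (j := 0) (SetLike.mul_mem_graded
        (degreeZeroSection_mem 𝒢 _) hx) (degreeZeroSection_mem 𝒢 _)
    obtain ⟨w, hw, hw1, hwz⟩ := hsand j i (Ideal.Quotient.mk (Ring.jacobson A ^ 2)
      (vertexMap 𝒢 j 1 * x * vertexMap 𝒢 i 1)) (AddSubgroup.subset_closure
        ⟨vertexMap 𝒢 j 1, x, vertexMap 𝒢 i 1,
          (mk_degreeZeroSection 𝒢 (1 : j.simpleIdeal.Component).1).symm ▸
            (1 : j.simpleIdeal.Component).2, ⟨x, hxr, rfl⟩,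
          (mk_degreeZeroSection 𝒢 (1 : i.simpleIdeal.Component).1).symm ▸
            (1 : i.simpleIdeal.Component).2, rfl⟩)
    -- Two elements of degree one whose difference has order at least two are equal, so no
    -- successive approximation is needed.
    rw [Ideal.Quotient.eq, jacobson_sq_eq_degreeGE 𝒢 h𝒢] at hwz
    rwa [← sub_eq_zero.1 (eq_zero_of_mem_of_mem_degreeGE one_lt_two (sub_mem hw1 hdeg) hwz)]
  have hall : ∀ n, ∀ x ∈ 𝒢 n, x ∈ φ.range := by
    intro n
    induction n with
    | zero => exact h0
    | succ n ih =>
      intro x hx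
      -- By strictness, degree `n + 1` is spanned by products of elements of degrees `n` and `1`.
      rw [← h𝒢] at hx
      induction hx using Submodule.mul_induction_on' with
      | mem_mul_mem a ha b hb => exact mul_mem (ih a ha) (h1 b hb)
      | add a _ b _ ha hb => exact add_mem ha hb
  intro x
  have hx : x ∈ φ.range.toSubsemiring.toAddSubmonoid :=
    mem_of_component_mem (𝒢 := 𝒢) (n := 0) (fun i hi => absurd hi (by simp)) _
      fun i _ => hall i _ (SetLike.coe_mem _)
  exact hx

end Presentation

end GenPath

end

/-! ### The generalized Gabriel theorem -/

open GenPath in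
theorem theorem2p4 {k : Type*} {A : Type*} [Field k] [Ring A] [Algebra k A]
    [IsArtinianRing A] (hA : IsRadicalGraded k A) :
    (∀ i : NaturalQuiver A, IsSimpleRing (vertexAlgebra A i)) ∧
    ∃ ρ : Set (PathAlgebra k (vertexAlgebra A)),
      (∀ σ ∈ ρ, PathAlgebra.IsRelation k σ) ∧
      PathAlgebra.IsAFinite k ρ ∧
      Nonempty (A ≃ₐ[k] PathAlgebra k (vertexAlgebra A) ⧸ PathAlgebra.ideal k ρ) ∧
      ∃ s : ℕ, 0 < s ∧
        PathAlgebra.J k (vertexAlgebra A) ^ s ≤ PathAlgebra.ideal k ρ ∧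
        PathAlgebra.ideal k ρ ≤ PathAlgebra.J k (vertexAlgebra A) := by
  refine ⟨fun i => inferInstanceAs (IsSimpleRing i.simpleIdeal.Component), ?_⟩
  obtain ⟨𝒢, _, h𝒢, _⟩ := hA
  choose g hg hgen using exists_arrow_lift 𝒢 h𝒢
  obtain ⟨s, hs0, hs⟩ := exists_degreeGE_eq_bot 𝒢
  -- The indices are swapped: arrows from `i` to `j` are generators of the bimodule with left action
  -- at `j` and right action at `i`.
  let γ : ∀ ⦃i j : NaturalQuiver A⦄, (i ⟶ j) → A := fun i j β => g j i β
  have hγ : ∀ ⦃i j : NaturalQuiver A⦄ (β : i ⟶ j), γ β ∈ 𝒢 1 := fun i j β => hg j i β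
  let φ := PathAlgebra.evalHom (isOrthogonalSystem_vertexMap 𝒢) γ
  have hfin : ∀ i j : NaturalQuiver A, Finite (i ⟶ j) := fun i j =>
    inferInstanceAs (Finite (Fin (natRank j i)))
  have hker : ∀ (i j : NaturalQuiver A) (p : APath (vertexAlgebra A) i j), p.length = s →
      PathAlgebra.ofPath k p ∈ RingHom.ker φ := by
    intro i j p hp
    have h := eval_mem_degreeGE hγ p
    rw [hp, hs, Submodule.mem_bot] at h
    exact (PathAlgebra.evalHom_ofPath _ γ p).trans h
  have hideal := PathAlgebra.ideal_shortRelations hker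
  -- The same `s`, the degree from which `A` vanishes, bounds the lengths in the relations and
  -- serves as the exponent of `J`.
  refine ⟨PathAlgebra.shortRelations k (RingHom.ker φ) s,
    fun σ hσ => PathAlgebra.isRelation_of_mem_shortRelations hσ,
    PathAlgebra.isAFinite_shortRelations _ s,
    ⟨((Ideal.quotientEquivAlgOfEq k hideal).trans
      (Ideal.quotientKerAlgEquivOfSurjective (evalHom_surjective hγ h𝒢 hgen))).symm⟩,
    s, hs0, ?_, ?_⟩
  · rw [hideal]
    intro x hx
    have h := J_pow_le_comap_degreeGE hγ s hx
    rwa [hs] at h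
  · rw [hideal]
    exact ker_evalHom_le_J hγ
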